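/- Let $n,m\in\mathbb{R}$. Consider the equation $$\partial_t\phi+\partial_x(\phi^n)-\partial_x\big[\phi^n\,\partial_x(\phi^{-m}\partial_t\phi)\big]=0,\qquad \lim_{|x|\to\infty}\phi(x,t)=1, \tag{1}$$ for $\phi=\phi(x,t)$, $x\in\mathbb{R}$, understood in the sense of distributions in $x$ at each time. For $a>0$ let $H^1_a=\{u: e^{ax}u\in H^1(\mathbb{R})\}$, $\|u\|_{H^1_a}=\|e^{ax}u\|_{H^1}$, and let $H^1\cap H^1_a$ have the norm $\|u\|_{H^1\cap H^1_a}=\|u\|_{H^1}+\|u\|_{H^1_a}$. Let $0<a<1$, $R\in\mathbb{R}$, $\alpha_0>0$ and $\beta_0>0$. There exists a constant $K=K(R,\alpha_0,\beta_0,a)$ (depending also on the fixed exponents $n,m$, but not on $T$ or on the solutions) such that the following holds. Let $T>0$ and let $\phi^{(1)},\phi^{(2)}$ be two solutions of (1) on $[0,T]$ with $\phi^{(j)}-1\in C^1([0,T];H^1\cap H^1_a)$, such that for $j=1,2$ and all $t\in[0,T]$ $$\|\phi^{(j)}(\cdot,t)-1\|_{H^1\cap H^1_a}\le R,\qquad \inf_x\phi^{(j)}(x,t)\ge\alpha_0,\qquad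 \inf_x\big(\phi^{(j)}(x,t)^m-a^2\phi^{(j)}(x,t)^n\big)\ge\beta_0 .$$ Then, with $\phi^{(j)}_0=\phi^{(j)}(\cdot,0)$, $$\|\phi^{(1)}(\cdot,t)-\phi^{(2)}(\cdot,t)\|_{H^1\cap H^1_a}\le e^{Kt}\,\|\phi^{(1)}_0-\phi^{(2)}_0\|_{H^1\cap H^1_a}\qquad\text{for all } t\in[0,T].$$ -/

import Mathlib

open MeasureTheory Set
open scoped ContDiff

/-- The space `L²(ℝ)` of real functions, with respect to Lebesgue measure. -/
abbrev L2 : Type := Lp ℝ 2 (volume : Measure ℝ)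

/-- Smooth compactly supported test functions on `ℝ`. -/
def IsTestFunction (η : ℝ → ℝ) : Prop :=
  ContDiff ℝ ∞ η ∧ HasCompactSupport η

/-- `g` is a weak derivative of `f` on `ℝ`. -/
def IsWeakDeriv (f g : ℝ → ℝ) : Prop :=
  LocallyIntegrable f ∧ LocallyIntegrable g ∧
    ∀ η : ℝ → ℝ, IsTestFunction η → ∫ x, f x * deriv η x = -∫ x, g x * η x

theorem IsTestFunction.integrable_mul {η f : ℝ → ℝ} (hη : IsTestFunction η)
    (hf : LocallyIntegrable f) : Integrable (fun x => f x * η x) := by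
  simpa [mul_comm] using
    hf.integrable_smul_left_of_hasCompactSupport hη.1.continuous hη.2

theorem IsTestFunction.integrable_mul_deriv {η f : ℝ → ℝ} (hη : IsTestFunction η)
    (hf : LocallyIntegrable f) : Integrable (fun x => f x * deriv η x) := by
  simpa [mul_comm] using
    hf.integrable_smul_left_of_hasCompactSupport
      (hη.1.continuous_deriv (by norm_num)) hη.2.deriv

theorem IsWeakDeriv.congr {f g f' g' : ℝ → ℝ} (h : IsWeakDeriv f g)
    (hf : f =ᵐ[volume] f') (hg : g =ᵐ[volume] g') : IsWeakDeriv f' g' := by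
  refine ⟨h.1.congr hf, h.2.1.congr hg, fun η hη => ?_⟩
  have h1 : ∫ x, f x * deriv η x = ∫ x, f' x * deriv η x :=
    integral_congr_ae (by filter_upwards [hf] with x hx; rw [hx])
  have h2 : ∫ x, g x * η x = ∫ x, g' x * η x :=
    integral_congr_ae (by filter_upwards [hg] with x hx; rw [hx])
  rw [← h1, ← h2]
  exact h.2.2 η hη

theorem IsWeakDeriv.add {f g f' g' : ℝ → ℝ} (h : IsWeakDeriv f g) (h' : IsWeakDeriv f' g') :
    IsWeakDeriv (f + f') (g + g') := by
  refine ⟨h.1.add h'.1, h.2.1.add h'.2.1, fun η hη => ?_⟩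
  simp only [Pi.add_apply, add_mul]
  rw [integral_add (hη.integrable_mul_deriv h.1) (hη.integrable_mul_deriv h'.1),
    integral_add (hη.integrable_mul h.2.1) (hη.integrable_mul h'.2.1),
    h.2.2 η hη, h'.2.2 η hη]
  ring

theorem IsWeakDeriv.const_smul {f g : ℝ → ℝ} (c : ℝ) (h : IsWeakDeriv f g) :
    IsWeakDeriv (c • f) (c • g) := by
  refine ⟨h.1.smul c, h.2.1.smul c, fun η hη => ?_⟩
  simp only [Pi.smul_apply, smul_eq_mul, mul_assoc]
  rw [integral_const_mul, integral_const_mul, h.2.2 η hη]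
  ring

theorem isWeakDeriv_zero : IsWeakDeriv 0 0 :=
  ⟨locallyIntegrable_zero, locallyIntegrable_zero, fun η _ => by simp⟩

/-- The Sobolev space `H¹(ℝ)`: pairs `(f, f')` in `L² × L²` with `f'` the weak derivative of `f`
(which is determined by `f`), with the norm `(‖f‖² + ‖f'‖²)^(1/2)`. -/
def H1 : Submodule ℝ (WithLp 2 (L2 × L2)) where
  carrier := {p | IsWeakDeriv p.fst p.snd}
  zero_mem' := isWeakDeriv_zero.congr (Lp.coeFn_zero ℝ 2 volume).symm
    (Lp.coeFn_zero ℝ 2 volume).symm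
  add_mem' := fun {p q} hp hq =>
    (IsWeakDeriv.add hp hq).congr (Lp.coeFn_add p.fst q.fst).symm (Lp.coeFn_add p.snd q.snd).symm
  smul_mem' := fun c p hp =>
    (IsWeakDeriv.const_smul c hp).congr (Lp.coeFn_smul c p.fst).symm (Lp.coeFn_smul c p.snd).symm

/-- The space `H¹ ∩ H¹ₐ`: pairs `(f, g)` of elements of `H¹` with `g(x) = exp(a x) f(x)`, so that
`f` ranges over the functions in `H¹` for which `exp(a x) f(x)` is in `H¹`.
The norm is `‖f‖_{H¹} + ‖exp(a x) f‖_{H¹}`. -/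
def H1capH1a (a : ℝ) : Submodule ℝ (WithLp 1 (H1 × H1)) where
  carrier := {p | p.snd.1.fst =ᵐ[volume] fun x => Real.exp (a * x) * p.fst.1.fst x}
  zero_mem' := by
    change ((0 : L2) : ℝ → ℝ) =ᵐ[volume] fun x => Real.exp (a * x) * ((0 : L2) : ℝ → ℝ) x
    filter_upwards [Lp.coeFn_zero ℝ 2 (volume : Measure ℝ)] with x hx
    rw [hx, Pi.zero_apply, mul_zero]
  add_mem' := by
    intro p q hp hq
    change ((p.snd.1.fst + q.snd.1.fst : L2) : ℝ → ℝ) =ᵐ[volume]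
      fun x => Real.exp (a * x) * ((p.fst.1.fst + q.fst.1.fst : L2) : ℝ → ℝ) x
    filter_upwards [hp, hq, Lp.coeFn_add p.fst.1.fst q.fst.1.fst,
      Lp.coeFn_add p.snd.1.fst q.snd.1.fst] with x h1 h2 h3 h4
    rw [h3, h4, Pi.add_apply, Pi.add_apply, h1, h2]
    ring
  smul_mem' := by
    intro c p hp
    change ((c • p.snd.1.fst : L2) : ℝ → ℝ) =ᵐ[volume]
      fun x => Real.exp (a * x) * ((c • p.fst.1.fst : L2) : ℝ → ℝ) x
    filter_upwards [hp, Lp.coeFn_smul c p.fst.1.fst,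
      Lp.coeFn_smul c p.snd.1.fst] with x h1 h2 h3
    rw [h2, h3, Pi.smul_apply, Pi.smul_apply, h1, smul_eq_mul, smul_eq_mul]
    ring

/-- The function `f : ℝ → ℝ` (defined up to null sets) underlying an element of `H¹ ∩ H¹ₐ`. -/
noncomputable def toFunction {a : ℝ} (p : H1capH1a a) : ℝ → ℝ := p.1.fst.1.fst

/-- The function `φ = 1 + f` attached to an element `f` of `H¹ ∩ H¹ₐ`. -/
noncomputable def porosity {a : ℝ} (p : H1capH1a a) : ℝ → ℝ := fun x => 1 + toFunction p x

/-- `φ` (at a fixed time, with time derivative `w`) satisfies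
`w + ∂ₓ(φⁿ) - ∂ₓ[φⁿ ∂ₓ(φ⁻ᵐ w)] = 0` in the sense of distributions on `ℝ`;
here `p` is the weak derivative `∂ₓ(φ⁻ᵐ w)`. -/
def MagmaEquation (n m : ℝ) (φ w : ℝ → ℝ) : Prop :=
  ∃ p : ℝ → ℝ, IsWeakDeriv (fun x => φ x ^ (-m) * w x) p ∧
    ∀ η : ℝ → ℝ, IsTestFunction η →
      (∫ x, w x * η x) - (∫ x, φ x ^ n * deriv η x)
        + (∫ x, φ x ^ n * p x * deriv η x) = 0

/-- `φ = 1 + u` is a solution of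
`∂ₜφ + ∂ₓ(φⁿ) - ∂ₓ[φⁿ ∂ₓ(φ⁻ᵐ ∂ₜφ)] = 0`, `φ(x, t) → 1` as `|x| → ∞`, with
`φ - 1 = u ∈ C¹([0,T]; H¹ ∩ H¹ₐ)`. The time derivative is the one of the curve `u` in
`H¹ ∩ H¹ₐ`, one-sided at `0` and `T`; the equation holds at each time in `[0,T]`.
The boundary condition is contained in `u t ∈ H¹`. -/
def IsMagmaSolution (n m a T : ℝ) (u : ℝ → H1capH1a a) : Prop :=
  ContDiffOn ℝ 1 u (Icc 0 T) ∧
    ∀ t ∈ Icc 0 T,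
      MagmaEquation n m (porosity (u t)) (toFunction (derivWithin u (Icc 0 T) t))

/-! At each fixed time the equation is a linear elliptic problem for `w = ∂ₜφ` with coefficients
depending on `φ`. The plan is to show that `u ↦ ∂ₜu` is Lipschitz on the set cut out by the bounds,
with a constant depending only on those bounds and the exponents, and to conclude with Gronwall's
inequality in `H¹ ∩ H¹ₐ`.

Put `g = exp(b x) φ⁻ᵐ w`. Integrating the equation once turns it into a first-order relation for a
flux: `q = φⁿ (g' - b g) - exp(b x) (φⁿ - 1)` satisfies `q' = b q + φᵐ g`
(`MagmaEquation.magmaProfile`). Pairing with `g` and using `∫ (q g)' = 0` produces the quadratic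
form `∫ (φᵐ - b² φⁿ) g² + φⁿ g'²`, since the two cross terms in `g g'` cancel. It is coercive for `b
= a` by the hypothesis with `β₀`, and for `b = 0` because `φ` lies in a compact subset of `(0, ∞)`.

Applied to the difference of two solutions, this bounds `g₁ - g₂` in `H¹` by `φ₁ - φ₂`
(`MagmaProfile.exists_energy_le`); multiplying back by `φᵐ` bounds the difference of the `exp(b x)
w` (`MagmaProfile.exists_sobolevSq_le`). The cases `b = 0` and `b = a` together give
`exists_norm_sub_le`. The products are controlled by the embedding of `H¹` in `L^∞`
(`IsSobolev.sq_le`). Weak derivatives are handled through absolutely continuous representatives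
(`IsWeakDeriv.exists_acDeriv`). -/

open Filter Topology

/-! ### Locally absolutely continuous functions -/

/-- `f` is absolutely continuous on every bounded interval, with almost everywhere derivative
`f'`. -/
structure ACDeriv (f f' : ℝ → ℝ) : Prop where
  ac : ∀ x y, AbsolutelyContinuousOnInterval f x y
  deriv : ∀ᵐ x : ℝ, HasDerivAt f (f' x) x

namespace ACDeriv

variable {f f' g g' : ℝ → ℝ}

theorem continuous (h : ACDeriv f f') : Continuous f := by
  rw [continuous_iff_continuousAt]
  intro x
  refine (h.ac (x - 1) (x + 1)).continuousOn.continuousAt ?_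
  rw [uIcc_of_le (by linarith)]
  exact Icc_mem_nhds (by linarith) (by linarith)

theorem congr_deriv (h : ACDeriv f f') (hg : f' =ᵐ[volume] g') : ACDeriv f g' :=
  ⟨h.ac, by filter_upwards [h.deriv, hg] with x hx hx'; rwa [← hx']⟩

theorem deriv_unique (h : ACDeriv f f') (h' : ACDeriv f g') : f' =ᵐ[volume] g' := by
  filter_upwards [h.deriv, h'.deriv] with x hx hx' using hx.unique hx'

theorem deriv_ae_eq (h : ACDeriv f f') : _root_.deriv f =ᵐ[volume] f' := by
  filter_upwards [h.deriv] with x hx using hx.deriv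

theorem integral_eq_sub (h : ACDeriv f f') (x y : ℝ) : ∫ t in x..y, f' t = f y - f x := by
  rw [← (h.ac x y).integral_deriv_eq_sub]
  refine intervalIntegral.integral_congr_ae ?_
  filter_upwards [h.deriv_ae_eq] with t ht _ using ht.symm

theorem add (h : ACDeriv f f') (h' : ACDeriv g g') :
    ACDeriv (fun x => f x + g x) (fun x => f' x + g' x) :=
  ⟨fun x y => (h.ac x y).fun_add (h'.ac x y), by
    filter_upwards [h.deriv, h'.deriv] with x hx hx' using hx.add hx'⟩

theorem sub (h : ACDeriv f f') (h' : ACDeriv g g') :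
    ACDeriv (fun x => f x - g x) (fun x => f' x - g' x) :=
  ⟨fun x y => (h.ac x y).fun_sub (h'.ac x y), by
    filter_upwards [h.deriv, h'.deriv] with x hx hx' using hx.sub hx'⟩

theorem mul (h : ACDeriv f f') (h' : ACDeriv g g') :
    ACDeriv (fun x => f x * g x) (fun x => f' x * g x + f x * g' x) :=
  ⟨fun x y => (h.ac x y).fun_mul (h'.ac x y), by
    filter_upwards [h.deriv, h'.deriv] with x hx hx' using hx.mul hx'⟩

theorem of_contDiff (hf : ContDiff ℝ 1 f) : ACDeriv f (_root_.deriv f) :=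
  ⟨fun _ _ => hf.contDiffOn.absolutelyContinuousOnInterval,
    Eventually.of_forall fun x => (hf.differentiable (by norm_num) x).hasDerivAt⟩

theorem const (c : ℝ) : ACDeriv (fun _ => c) (fun _ => 0) := by
  simpa using of_contDiff (f := fun _ => c) contDiff_const

theorem exp_mul (b : ℝ) :
    ACDeriv (fun x => Real.exp (b * x)) (fun x => b * Real.exp (b * x)) := by
  refine (of_contDiff (by fun_prop)).congr_deriv (Eventually.of_forall fun x => ?_)
  have := ((hasDerivAt_id x).const_mul b).exp
  simp only [id, mul_one] at this
  rw [this.deriv, mul_comm]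

/-- A Lipschitz outer function preserves absolute continuity. Only its behaviour on a set containing
the values of `f` matters, which allows real powers away from zero. -/
theorem comp {F F' : ℝ → ℝ} {S : Set ℝ} {K : NNReal} (hF : ∀ s ∈ S, HasDerivAt F (F' s) s)
    (hK : LipschitzOnWith K F S) (hS : ∀ x, f x ∈ S) (h : ACDeriv f f') :
    ACDeriv (fun x => F (f x)) (fun x => F' (f x) * f' x) := by
  refine ⟨fun x y => ?_, ?_⟩
  · rw [absolutelyContinuousOnInterval_iff]
    intro ε hε
    obtain ⟨δ, hδ, H⟩ := (absolutelyContinuousOnInterval_iff _ _ _).1 (h.ac x y)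
      (ε / (K + 1)) (by positivity)
    refine ⟨δ, hδ, fun E hE hE' => ?_⟩
    have h1 := H E hE hE'
    rw [lt_div_iff₀ (by positivity)] at h1
    refine lt_of_le_of_lt ?_ h1
    rw [Finset.sum_mul]
    refine Finset.sum_le_sum fun i _ => ?_
    have h2 := hK.dist_le_mul _ (hS (E.2 i).1) _ (hS (E.2 i).2)
    have h3 : 0 ≤ dist (f (E.2 i).1) (f (E.2 i).2) := dist_nonneg
    nlinarith
  · filter_upwards [h.deriv] with x hx using (hF _ (hS x)).comp x hx

theorem primitive (hf : LocallyIntegrable f) : ACDeriv (fun x => ∫ t in (0 : ℝ)..x, f t) f := by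
  refine ⟨fun x y => ?_, ?_⟩
  · have h1 : AbsolutelyContinuousOnInterval (fun x => ∫ t in (0 : ℝ)..x, f t)
        (min 0 (min x y)) (max 0 (max x y)) :=
      (hf.integrableOn_isCompact isCompact_uIcc).intervalIntegrable.absolutelyContinuousOnInterval_intervalIntegral
        (by rw [uIcc_of_le (by simp)]; simp)
    refine h1.mono ?_
    rw [uIcc_of_le (a := min 0 (min x y)) (by simp)]
    exact Icc_subset_Icc (min_le_right _ _) (le_max_right _ _)
  · filter_upwards [_root_.LocallyIntegrable.ae_hasDerivAt_integral hf] with x hx using hx 0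

/-- An integrable locally absolutely continuous function has an integrable derivative of mean
zero, if that derivative is integrable. -/
theorem integral_eq_zero (h : ACDeriv f f') (hf : Integrable f) (hf' : Integrable f') :
    ∫ x, f' x = 0 := by
  -- Integrability of `f'` gives `f` limits at both ends, and integrability of `f` forces both
  -- limits to be zero.
  have h1 : Tendsto (fun x => f 0 + ∫ t in (0 : ℝ)..x, f' t) atTop
      (𝓝 (f 0 + ∫ t in Ioi 0, f' t)) :=
    (intervalIntegral_tendsto_integral_Ioi 0 hf'.integrableOn tendsto_id).const_add _
  have h2 : Tendsto (fun x => f 0 - ∫ t in x..(0 : ℝ), f' t) atBot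
      (𝓝 (f 0 - ∫ t in Iic 0, f' t)) :=
    (intervalIntegral_tendsto_integral_Iic 0 hf'.integrableOn tendsto_id).const_sub _
  simp only [h.integral_eq_sub, add_sub_cancel, sub_sub_cancel] at h1 h2
  have h3 := (hf.integrableAtFilter atTop).eq_zero_of_tendsto (fun s hs => by
    rcases mem_atTop_sets.1 hs with ⟨b, hb⟩
    rw [← top_le_iff, ← Real.volume_Ici (a := b)]
    exact measure_mono hb) h1
  have h4 := (hf.integrableAtFilter atBot).eq_zero_of_tendsto (fun s hs => by
    rcases mem_atBot_sets.1 hs with ⟨b, hb⟩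
    rw [← top_le_iff, ← Real.volume_Iic (a := b)]
    exact measure_mono hb) h2
  rw [← intervalIntegral.integral_Iic_add_Ioi (b := 0) hf'.integrableOn hf'.integrableOn]
  linarith

end ACDeriv

/-! ### Weak derivatives -/

theorem HasCompactSupport.exists_forall_abs_ge {η : ℝ → ℝ} (h : HasCompactSupport η) :
    ∃ N > 0, ∀ x, N ≤ |x| → η x = 0 := by
  obtain ⟨N, hN⟩ := h.isCompact.isBounded.subset_closedBall 0
  refine ⟨|N| + 1, by positivity, fun x hx => ?_⟩
  by_contra hne
  have h1 := hN (subset_tsupport _ hne)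
  rw [mem_closedBall_zero_iff, Real.norm_eq_abs] at h1
  have := le_abs_self N
  linarith

theorem integral_eq_intervalIntegral {u : ℝ → ℝ} {N : ℝ} (hN : 0 < N)
    (h : ∀ x, N ≤ |x| → u x = 0) : ∫ x, u x = ∫ x in (-N)..N, u x := by
  rw [intervalIntegral.integral_of_le (by linarith), setIntegral_eq_integral_of_forall_compl_eq_zero]
  intro x hx
  refine h x ?_
  by_contra hlt
  rw [not_le, abs_lt] at hlt
  exact hx ⟨hlt.1, hlt.2.le⟩

theorem deriv_eq_zero_of_forall_abs_ge {η : ℝ → ℝ} {N : ℝ} (h : ∀ x, N ≤ |x| → η x = 0) (x : ℝ)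
    (hx : N < |x|) : deriv η x = 0 := by
  have : η =ᶠ[𝓝 x] fun _ => 0 := by
    filter_upwards [(isOpen_lt continuous_const continuous_abs).mem_nhds hx] with y hy
      using h y (le_of_lt hy)
  rw [this.deriv_eq, deriv_const]

theorem ACDeriv.isWeakDeriv {f f' : ℝ → ℝ} (h : ACDeriv f f') (hf' : LocallyIntegrable f') :
    IsWeakDeriv f f' := by
  refine ⟨h.continuous.locallyIntegrable, hf', fun η hη => ?_⟩
  obtain ⟨N, hN, hz⟩ := hη.2.exists_forall_abs_ge
  have hz' := deriv_eq_zero_of_forall_abs_ge hz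
  -- `deriv η` is only known to vanish strictly beyond `N`, hence the interval with endpoints `±(N +
  -- 1)`.
  rw [integral_eq_intervalIntegral (N := N + 1) (by linarith)
      (fun x hx => by rw [hz' x (by linarith), mul_zero]),
    integral_eq_intervalIntegral (N := N + 1) (by linarith)
      (fun x hx => by rw [hz x (by linarith), mul_zero]),
    (h.ac _ _).integral_mul_deriv_eq_deriv_mul
      ((ACDeriv.of_contDiff (hη.1.of_le (by norm_num))).ac _ _),
    hz (N + 1) (by rw [abs_of_pos] <;> linarith),
    hz (-(N + 1)) (by rw [abs_of_neg] <;> linarith)]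
  simp only [mul_zero, sub_zero, zero_sub]
  congr 1
  refine intervalIntegral.integral_congr_ae ?_
  filter_upwards [h.deriv_ae_eq] with x hx _
  rw [hx]

/-- A test function of mean zero is the derivative of a test function. -/
theorem IsTestFunction.exists_deriv_eq {ψ : ℝ → ℝ} (hψ : IsTestFunction ψ)
    (h0 : ∫ x, ψ x = 0) : ∃ η, IsTestFunction η ∧ deriv η = ψ := by
  obtain ⟨N, hN, hz⟩ := hψ.2.exists_forall_abs_ge
  have hc := hψ.1.continuous
  have hd : ∀ x, HasDerivAt (fun x => ∫ t in (-N)..x, ψ t) (ψ x) x := fun x =>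
    intervalIntegral.integral_hasDerivAt_right (hc.intervalIntegrable _ _)
      (hc.stronglyMeasurableAtFilter _ _) hc.continuousAt
  have hderiv : deriv (fun x => ∫ t in (-N)..x, ψ t) = ψ := funext fun x => (hd x).deriv
  refine ⟨fun x => ∫ t in (-N)..x, ψ t, ⟨?_, ?_⟩, hderiv⟩
  · rw [contDiff_infty_iff_deriv, hderiv]
    exact ⟨fun x => (hd x).differentiableAt, hψ.1⟩
  · refine HasCompactSupport.of_support_subset_isCompact (isCompact_Icc (a := -N) (b := N)) ?_
    intro x hx
    by_contra hxN
    refine hx ?_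
    rw [mem_Icc, not_and_or, not_le, not_le] at hxN
    rcases hxN with hlt | hgt
    · change ∫ t in (-N)..x, ψ t = 0
      rw [intervalIntegral.integral_symm, intervalIntegral.integral_of_le hlt.le,
        setIntegral_eq_zero_of_forall_eq_zero, neg_zero]
      intro t ht
      refine hz t ?_
      rw [abs_of_nonpos (by linarith [ht.2])]
      linarith [ht.2]
    · change ∫ t in (-N)..x, ψ t = 0
      rw [← intervalIntegral.integral_add_adjacent_intervals (hc.intervalIntegrable (-N) N)
        (hc.intervalIntegrable N x), ← integral_eq_intervalIntegral hN hz, h0,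
        intervalIntegral.integral_of_le hgt.le, setIntegral_eq_zero_of_forall_eq_zero, zero_add]
      intro t ht
      exact hz t (ht.1.le.trans (le_abs_self t))

theorem exists_isTestFunction_integral_eq_one : ∃ η, IsTestFunction η ∧ ∫ x, η x = 1 := by
  let B : ContDiffBump (0 : ℝ) := ⟨1, 2, by norm_num, by norm_num⟩
  exact ⟨B.normed volume, ⟨B.contDiff_normed, B.hasCompactSupport_normed⟩, B.integral_normed⟩

/-- The du Bois-Reymond lemma: a function with zero weak derivative is constant. -/
theorem IsWeakDeriv.ae_eq_const {f : ℝ → ℝ} (h : IsWeakDeriv f 0) :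
    ∃ c : ℝ, ∀ᵐ x : ℝ, f x = c := by
  obtain ⟨η₀, hη₀, h1⟩ := exists_isTestFunction_integral_eq_one
  refine ⟨∫ x, f x * η₀ x, ae_eq_of_integral_contDiff_smul_eq h.1
    (locallyIntegrable_const _) fun ψ hψ hψ' => ?_⟩
  have hψi : Integrable ψ := hψ.continuous.integrable_of_hasCompactSupport hψ'
  have hηi : Integrable η₀ := hη₀.1.continuous.integrable_of_hasCompactSupport hη₀.2
  -- Subtracting a multiple of `η₀` makes the mean zero, so the result is the derivative of a test
  -- function and `f` integrates to zero against it.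
  have ht : IsTestFunction (fun x => ψ x - (∫ y, ψ y) * η₀ x) :=
    ⟨hψ.sub (contDiff_const.mul hη₀.1), hψ'.sub (hη₀.2.mul_left)⟩
  obtain ⟨θ, hθ, hθ'⟩ := ht.exists_deriv_eq (by
    rw [integral_sub hψi (hηi.const_mul _), integral_const_mul, h1, mul_one, sub_self])
  have h2 := h.2.2 θ hθ
  have hfψ : Integrable fun x => f x * ψ x := IsTestFunction.integrable_mul ⟨hψ, hψ'⟩ h.1
  have hfη : Integrable fun x => f x * η₀ x := hη₀.integrable_mul h.1
  simp only [hθ', Pi.zero_apply, zero_mul, integral_zero, neg_zero, mul_sub] at h2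
  have h3 : ∀ x, f x * ((∫ y, ψ y) * η₀ x) = (∫ y, ψ y) * (f x * η₀ x) := fun x => by ring
  simp only [h3] at h2
  rw [integral_sub hfψ (hfη.const_mul _), integral_const_mul] at h2
  simp only [smul_eq_mul]
  rw [integral_mul_const]
  simp only [mul_comm (ψ _)]
  linarith

/-- The function minus a primitive of its weak derivative has weak derivative zero, hence is a
constant by du Bois-Reymond. -/
theorem IsWeakDeriv.exists_acDeriv {f g : ℝ → ℝ} (h : IsWeakDeriv f g) :
    ∃ F, F =ᵐ[volume] f ∧ ACDeriv F g := by
  have hP := ACDeriv.primitive h.2.1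
  have h1 : IsWeakDeriv (f + (-1 : ℝ) • fun x => ∫ t in (0 : ℝ)..x, g t) (g + (-1 : ℝ) • g) :=
    h.add ((hP.isWeakDeriv h.2.1).const_smul (-1))
  rw [show g + (-1 : ℝ) • g = 0 by ext x; simp] at h1
  obtain ⟨c, hc⟩ := h1.ae_eq_const
  refine ⟨fun x => (∫ t in (0 : ℝ)..x, g t) + c, ?_, ?_⟩
  · filter_upwards [hc] with x hx
    simp only [Pi.add_apply, Pi.smul_apply, smul_eq_mul] at hx
    linarith
  · simpa using hP.add (ACDeriv.const c)

/-! ### Functions in `H¹` -/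

/-- `f` is a locally absolutely continuous function in `H¹(ℝ)` with derivative `f'`. -/
structure IsSobolev (f f' : ℝ → ℝ) : Prop where
  acDeriv : ACDeriv f f'
  memLp : MemLp f 2
  memLp_deriv : MemLp f' 2

/-- The squared norm `∫ f² + f'²` of `H¹(ℝ)`. -/
noncomputable def sobolevSq (f f' : ℝ → ℝ) : ℝ := ∫ x, (f x ^ 2 + f' x ^ 2)

namespace IsSobolev

variable {f f' g g' : ℝ → ℝ}

theorem integrable_sq (h : IsSobolev f f') : Integrable fun x => f x ^ 2 + f' x ^ 2 :=
  h.memLp.integrable_sq.add h.memLp_deriv.integrable_sq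

theorem sub (h : IsSobolev f f') (h' : IsSobolev g g') :
    IsSobolev (fun x => f x - g x) (fun x => f' x - g' x) :=
  ⟨h.acDeriv.sub h'.acDeriv, h.memLp.sub h'.memLp, h.memLp_deriv.sub h'.memLp_deriv⟩

theorem integrable_mul_deriv (h : IsSobolev f f') (h' : IsSobolev g g') :
    Integrable fun x => f' x * g x + f x * g' x :=
  (h.memLp_deriv.integrable_mul h'.memLp).add (h.memLp.integrable_mul h'.memLp_deriv)

theorem integral_mul_deriv (h : IsSobolev f f') (h' : IsSobolev g g') :
    ∫ x, (f' x * g x + f x * g' x) = 0 :=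
  (h.acDeriv.mul h'.acDeriv).integral_eq_zero (h.memLp.integrable_mul h'.memLp)
    (h.integrable_mul_deriv h')

theorem sobolevSq_nonneg : 0 ≤ sobolevSq f f' := integral_nonneg fun x => by positivity

/-- The Sobolev embedding `H¹(ℝ) ⊆ L^∞(ℝ)`. -/
theorem sq_le (h : IsSobolev f f') (x : ℝ) : f x ^ 2 ≤ 2 * sobolevSq f f' := by
  have hE := h.integrable_sq
  -- From `f y ^ 2 - f x ^ 2 = ∫ 2 f f'` and `2 |f f'| ≤ f² + f'²`; averaging over the unit interval
  -- then gives the factor 2.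
  have key : ∀ y ∈ Icc x (x + 1), f x ^ 2 - sobolevSq f f' ≤ f y ^ 2 := by
    intro y hy
    have h1 := (h.acDeriv.mul h.acDeriv).integral_eq_sub x y
    have h2 : |∫ t in x..y, f' t * f t + f t * f' t| ≤ sobolevSq f f' := by
      rw [intervalIntegral.integral_of_le hy.1]
      refine (abs_integral_le_integral_abs).trans ?_
      refine (integral_mono_ae (h.integrable_mul_deriv h).integrableOn.abs hE.integrableOn
        (Eventually.of_forall fun t => ?_)).trans
        (setIntegral_le_integral hE (Eventually.of_forall fun t => by positivity))
      rw [abs_le]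
      constructor <;> nlinarith [sq_nonneg (f t + f' t), sq_nonneg (f t - f' t)]
    have h3 := (abs_le.1 h2).1
    nlinarith
  have h1 : ∫ _y in x..(x + 1), (f x ^ 2 - sobolevSq f f') ≤ ∫ y in x..(x + 1), f y ^ 2 :=
    intervalIntegral.integral_mono_on (by linarith) intervalIntegrable_const
      (h.memLp.integrable_sq.intervalIntegrable) key
  have h2 : ∫ y in x..(x + 1), f y ^ 2 ≤ sobolevSq f f' := by
    rw [intervalIntegral.integral_of_le (by linarith)]
    refine (setIntegral_le_integral h.memLp.integrable_sq
      (Eventually.of_forall fun t => by positivity)).trans ?_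
    exact integral_mono h.memLp.integrable_sq hE fun t => by simp only; nlinarith [sq_nonneg (f' t)]
  rw [intervalIntegral.integral_const, add_sub_cancel_left, one_smul] at h1
  linarith

end IsSobolev

/-! ### Powers on compact intervals -/

theorem hasDerivAt_rpow_of_mem_Icc {α M s : ℝ} (hα : 0 < α) (hs : s ∈ Icc α M) (r : ℝ) :
    HasDerivAt (fun s : ℝ => s ^ r) (r * s ^ (r - 1)) s :=
  Real.hasDerivAt_rpow_const (Or.inl (hα.trans_le hs.1).ne')

theorem exists_lipschitzOnWith_rpow {α : ℝ} (hα : 0 < α) (M r : ℝ) :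
    ∃ K, LipschitzOnWith K (fun s : ℝ => s ^ r) (Icc α M) := by
  refine ContDiffOn.exists_lipschitzOnWith (n := 1) (fun s hs => ?_) (by norm_num)
    (convex_Icc _ _) isCompact_Icc
  exact (Real.contDiffAt_rpow_const_of_ne (hα.trans_le hs.1).ne').contDiffWithinAt

theorem exists_abs_rpow_sub_le {α : ℝ} (hα : 0 < α) (M r : ℝ) :
    ∃ K > 0, ∀ s ∈ Icc α M, ∀ t ∈ Icc α M, |s ^ r - t ^ r| ≤ K * |s - t| := by
  obtain ⟨K, hK⟩ := exists_lipschitzOnWith_rpow hα M r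
  refine ⟨K + 1, by positivity, fun s hs t ht => ?_⟩
  have h1 := hK.dist_le_mul s hs t ht
  rw [Real.dist_eq, Real.dist_eq] at h1
  nlinarith [abs_nonneg (s - t)]

theorem continuousOn_rpow_Icc {α : ℝ} (hα : 0 < α) (M r : ℝ) :
    ContinuousOn (fun s : ℝ => s ^ r) (Icc α M) := fun _ hs =>
  (Real.continuousAt_rpow_const _ _ (Or.inl (hα.trans_le hs.1).ne')).continuousWithinAt

theorem exists_le_rpow {α M : ℝ} (hα : 0 < α) (hM : α ≤ M) (r : ℝ) :
    ∃ c > 0, ∀ s ∈ Icc α M, c ≤ s ^ r := by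
  obtain ⟨s, hs, h⟩ := isCompact_Icc.exists_isMinOn (nonempty_Icc.2 hM)
    (continuousOn_rpow_Icc hα M r)
  exact ⟨s ^ r, Real.rpow_pos_of_pos (hα.trans_le hs.1) r, fun t ht => h ht⟩

theorem exists_abs_rpow_le {α : ℝ} (hα : 0 < α) (M r : ℝ) :
    ∃ C > 0, ∀ s ∈ Icc α M, |s ^ r| ≤ C := by
  obtain ⟨C, hC⟩ := isCompact_Icc.exists_bound_of_continuousOn (continuousOn_rpow_Icc hα M r)
  exact ⟨|C| + 1, by positivity, fun s hs =>
    (hC s hs).trans ((le_abs_self C).trans (by linarith))⟩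

theorem continuous_rpow_comp {φ : ℝ → ℝ} {α M : ℝ} (hα : 0 < α) (hφ : Continuous φ)
    (hmem : ∀ x, φ x ∈ Icc α M) (r : ℝ) : Continuous fun x => φ x ^ r :=
  hφ.rpow_const fun x => Or.inl (hα.trans_le (hmem x).1).ne'

theorem ACDeriv.rpow {φ φ' : ℝ → ℝ} {α M : ℝ} (hα : 0 < α) (h : ACDeriv φ φ')
    (hmem : ∀ x, φ x ∈ Icc α M) (r : ℝ) :
    ACDeriv (fun x => φ x ^ r) (fun x => r * φ x ^ (r - 1) * φ' x) := by
  obtain ⟨K, hK⟩ := exists_lipschitzOnWith_rpow hα M r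
  exact ACDeriv.comp (fun s hs => hasDerivAt_rpow_of_mem_Icc hα hs r) hK hmem h

theorem MeasureTheory.MemLp.bounded_mul {f u : ℝ → ℝ} {C : ℝ} (hf : MemLp f 2)
    (hu : Continuous u) (hC : ∀ x, |u x| ≤ C) : MemLp (fun x => u x * f x) 2 :=
  hf.of_le_mul (c := C) (hu.aestronglyMeasurable.mul hf.1) (Eventually.of_forall fun x => by
    rw [norm_mul]
    exact mul_le_mul_of_nonneg_right (hC x) (norm_nonneg _))

theorem IsSobolev.abs_le {f f' : ℝ → ℝ} (h : IsSobolev f f') (x : ℝ) :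
    |f x| ≤ √(2 * sobolevSq f f') :=
  Real.abs_le_sqrt (h.sq_le x)

/-- Since `φ'` is merely in `L²`, the term `φ' y` is in `L²` because `y` is bounded by the Sobolev
embedding. The factor `φ` is not itself assumed to be in `L²`. -/
theorem IsSobolev.rpow_mul {φ φ' y y' : ℝ → ℝ} {α M : ℝ} (hα : 0 < α) (h : ACDeriv φ φ')
    (hφ' : MemLp φ' 2) (hmem : ∀ x, φ x ∈ Icc α M) (hy : IsSobolev y y') (r : ℝ) :
    IsSobolev (fun x => φ x ^ r * y x)
      (fun x => r * φ x ^ (r - 1) * φ' x * y x + φ x ^ r * y' x) := by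
  have hc := continuous_rpow_comp hα h.continuous hmem
  obtain ⟨C, -, hC⟩ := exists_abs_rpow_le hα M r
  obtain ⟨D, -, hD⟩ := exists_abs_rpow_le hα M (r - 1)
  refine ⟨(h.rpow hα hmem r).mul hy.acDeriv,
    hy.memLp.bounded_mul (hc r) fun x => hC _ (hmem x), ?_⟩
  refine MemLp.add ?_ (hy.memLp_deriv.bounded_mul (hc r) fun x => hC _ (hmem x))
  have h1 : MemLp (fun x => (φ x ^ (r - 1) * y x) * φ' x) 2 :=
    hφ'.bounded_mul ((hc (r - 1)).mul hy.acDeriv.continuous)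
      (C := D * √(2 * sobolevSq y y')) fun x => by
        rw [abs_mul]
        exact mul_le_mul (hD _ (hmem x)) (hy.abs_le x) (abs_nonneg _)
          ((abs_nonneg _).trans (hD _ (hmem x)))
  exact (h1.const_mul r).ae_eq (Eventually.of_forall fun x => by simp only; ring)

/-! ### The weighted energy estimate -/

/-- Weighted form of the equation at a fixed time: `φ` takes values in `[α, M]`, and
`g = exp(b x) φ⁻ᵐ ∂ₜφ` is an `H¹` solution of
`(b - ∂ₓ)[φⁿ (g' - b g) - exp(b x) (φⁿ - 1)] + φᵐ g = 0`. -/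
structure MagmaProfile (n m b α M : ℝ) (φ g g' : ℝ → ℝ) : Prop where
  continuous : Continuous φ
  mem : ∀ x, φ x ∈ Icc α M
  memLp : MemLp (fun x => Real.exp (b * x) * (φ x - 1)) 2
  sobolev : IsSobolev g g'
  flux : ∃ q, ACDeriv q (fun x => b * q x + φ x ^ m * g x) ∧
    q =ᵐ[volume] fun x => φ x ^ n * (g' x - b * g x) - Real.exp (b * x) * (φ x ^ n - 1)

/-- The trivial steady state; comparing a profile with it turns the difference estimate into an a
priori bound. -/
theorem MagmaProfile.one_zero {n m b α M : ℝ} (hα : α ≤ 1) (hM : 1 ≤ M) :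
    MagmaProfile n m b α M (fun _ => 1) (fun _ => 0) (fun _ => 0) where
  continuous := continuous_const
  mem _ := ⟨hα, hM⟩
  memLp := by simp
  sobolev := ⟨ACDeriv.const 0, by simp, by simp⟩
  flux := ⟨fun _ => 0, by simpa using ACDeriv.const 0, by simp⟩

/-- The weighted term is in `L²` because `|φⁿ - 1| ≤ K |φ - 1|` on `[α, M]`, an interval containing
1. This regularity justifies integrating by parts over the whole line. -/
theorem MagmaProfile.isSobolev_flux {n m b α M : ℝ} {φ g g' q : ℝ → ℝ} (hα : 0 < α) (hα1 : α ≤ 1)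
    (hM : 1 ≤ M) (h : MagmaProfile n m b α M φ g g')
    (hq : ACDeriv q (fun x => b * q x + φ x ^ m * g x))
    (hq' : q =ᵐ[volume] fun x =>
      φ x ^ n * (g' x - b * g x) - Real.exp (b * x) * (φ x ^ n - 1)) :
    IsSobolev q (fun x => b * q x + φ x ^ m * g x) := by
  have hc := continuous_rpow_comp hα h.continuous h.mem
  obtain ⟨C, -, hC⟩ := exists_abs_rpow_le hα M n
  obtain ⟨D, -, hD⟩ := exists_abs_rpow_le hα M m
  obtain ⟨K, -, hK⟩ := exists_abs_rpow_sub_le hα M n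
  have h1 : MemLp (fun x => φ x ^ n * (g' x - b * g x)) 2 :=
    (h.sobolev.memLp_deriv.sub (h.sobolev.memLp.const_mul b)).bounded_mul (hc n)
      fun x => hC _ (h.mem x)
  have h2 : MemLp (fun x => Real.exp (b * x) * (φ x ^ n - 1)) 2 := by
    refine h.memLp.of_le_mul (c := K) ?_ (Eventually.of_forall fun x => ?_)
    · exact (((Real.continuous_exp.comp (continuous_const.mul continuous_id)).mul
        ((hc n).sub continuous_const))).aestronglyMeasurable
    · rw [norm_mul, norm_mul, Real.norm_eq_abs (φ x ^ n - 1), Real.norm_eq_abs (φ x - 1)]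
      have := hK _ (h.mem x) 1 ⟨hα1, hM⟩
      rw [Real.one_rpow] at this
      calc _ ≤ ‖Real.exp (b * x)‖ * (K * |φ x - 1|) := by gcongr
        _ = _ := by ring
  have h3 : MemLp q 2 := (memLp_congr_ae hq').2 (h1.sub h2)
  exact ⟨hq, h3, (h3.const_mul b).add (h.sobolev.memLp.bounded_mul (hc m) fun x => hD _ (h.mem x))⟩

theorem flux_difference_sq_le {b L s δ e dn g g' : ℝ} (hn : dn ^ 2 ≤ L * δ ^ 2)
    (hL : L * δ ^ 2 ≤ L * s) (hL0 : 0 ≤ L) :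
    (dn * (g' - b * g) - e * dn) ^ 2 ≤
      4 * L * (1 + b ^ 2) * ((e * δ) ^ 2 + s * (g ^ 2 + g' ^ 2)) := by
  have h1 : (dn * (g' - b * g) - e * dn) ^ 2 ≤
      2 * (dn ^ 2 * (g' - b * g) ^ 2) + 2 * (dn ^ 2 * e ^ 2) := by
    have : 0 ≤ (dn * (g' - b * g) + e * dn) ^ 2 := sq_nonneg _
    linarith
  have h2 : dn ^ 2 * (g' - b * g) ^ 2 ≤ L * s * (2 * (1 + b ^ 2) * (g ^ 2 + g' ^ 2)) := by
    refine mul_le_mul (hn.trans hL) ?_ (sq_nonneg _) ((sq_nonneg _).trans (hn.trans hL))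
    have h3 : 0 ≤ (g' + b * g) ^ 2 := sq_nonneg _
    have h4 : 0 ≤ (b * g') ^ 2 := sq_nonneg _
    have h5 : 0 ≤ g ^ 2 := sq_nonneg _
    linarith
  have h3 : dn ^ 2 * e ^ 2 ≤ L * δ ^ 2 * e ^ 2 := mul_le_mul_of_nonneg_right hn (sq_nonneg e)
  have h4 : 0 ≤ b ^ 2 * (L * (e * δ) ^ 2) := by positivity
  have h5 : 0 ≤ L * (e * δ) ^ 2 := by positivity
  linarith

theorem neg_le_mul_of_pos {κ : ℝ} (hκ : 0 < κ) (x y : ℝ) :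
    -(κ / 4 * y ^ 2 + x ^ 2 / κ) ≤ x * y := by
  have h1 : x * y + (κ / 4 * y ^ 2 + x ^ 2 / κ) = (κ / 2 * y + x) ^ 2 / κ := by
    field_simp; ring
  have h2 : 0 ≤ (κ / 2 * y + x) ^ 2 / κ := by positivity
  linarith

/-- Pointwise coercivity for the difference of two profiles: `G` is the difference of the `g`, while
`dn` and `dm` are the differences of `φⁿ` and `φᵐ`. The unweighted `δ` multiplying `g, g'` is
measured in sup norm through `s`; only `e * δ` carries the weight. -/
theorem energy_density_le {κ b L s δ e N P dn dm G G' g g' : ℝ} (hκ : 0 < κ)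
    (hP : κ ≤ P - b ^ 2 * N) (hN : κ ≤ N) (hn : |dn| ≤ L * |δ|) (hm : |dm| ≤ L * |δ|)
    (hs : δ ^ 2 ≤ s) :
    κ / 2 * (G ^ 2 + G' ^ 2) ≤
      ((b * (N * (G' - b * G) + dn * (g' - b * g) - e * dn) + P * G + dm * g) * G
        + (N * (G' - b * G) + dn * (g' - b * g) - e * dn) * G')
      + L ^ 2 * (4 * (1 + b ^ 2) ^ 2 + 1) / κ * ((e * δ) ^ 2 + s * (g ^ 2 + g' ^ 2)) := by
  have hn2 : dn ^ 2 ≤ L ^ 2 * δ ^ 2 := by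
    rw [← sq_abs dn, ← sq_abs δ, ← mul_pow]; gcongr
  have hm2 : dm ^ 2 ≤ L ^ 2 * δ ^ 2 := by
    rw [← sq_abs dm, ← sq_abs δ, ← mul_pow]; gcongr
  have hL : L ^ 2 * δ ^ 2 ≤ L ^ 2 * s := by gcongr
  have hX2 := flux_difference_sq_le (b := b) (e := e) (g := g) (g' := g') hn2 hL (sq_nonneg L)
  have expand : (b * (N * (G' - b * G) + dn * (g' - b * g) - e * dn) + P * G + dm * g) * G
        + (N * (G' - b * G) + dn * (g' - b * g) - e * dn) * G'
      = (P - b ^ 2 * N) * G ^ 2 + N * G' ^ 2 + (dn * (g' - b * g) - e * dn) * G'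
        + b * (dn * (g' - b * g) - e * dn) * G + dm * g * G := by
    ring
  rw [expand]
  generalize dn * (g' - b * g) - e * dn = X at hX2 ⊢
  have hE2 : (dm * g) ^ 2 ≤ L ^ 2 * ((e * δ) ^ 2 + s * (g ^ 2 + g' ^ 2)) := by
    have h1 := mul_le_mul_of_nonneg_right (hm2.trans hL) (sq_nonneg g)
    have h2 : 0 ≤ L ^ 2 * s := (sq_nonneg _).trans (hm2.trans hL)
    have h3 : 0 ≤ L ^ 2 * s * g' ^ 2 := by positivity
    have h4 : 0 ≤ L ^ 2 * (e * δ) ^ 2 := by positivity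
    linarith
  generalize (e * δ) ^ 2 + s * (g ^ 2 + g' ^ 2) = W at hX2 hE2 ⊢
  -- Each use of Young's inequality costs `κ / 4`: once for `G'` and twice for `G`, so `κ / 2` of
  -- the coercivity survives.
  have y1 := neg_le_mul_of_pos hκ X G'
  have y2 := neg_le_mul_of_pos hκ (b * X) G
  have y3 := neg_le_mul_of_pos hκ (dm * g) G
  have y4 : ((1 + b ^ 2) * X ^ 2 + (dm * g) ^ 2) / κ ≤
      L ^ 2 * (4 * (1 + b ^ 2) ^ 2 + 1) / κ * W := by
    rw [div_mul_eq_mul_div]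
    gcongr
    have := mul_le_mul_of_nonneg_left hX2 (by positivity : 0 ≤ 1 + b ^ 2)
    linarith
  have y5 : ((1 + b ^ 2) * X ^ 2 + (dm * g) ^ 2) / κ =
      X ^ 2 / κ + (b * X) ^ 2 / κ + (dm * g) ^ 2 / κ := by ring
  have p1 : κ * G ^ 2 ≤ (P - b ^ 2 * N) * G ^ 2 := by gcongr
  have p2 : κ * G' ^ 2 ≤ N * G' ^ 2 := by gcongr
  have p3 : 0 ≤ κ * G' ^ 2 := by positivity
  rw [y5] at y4
  linarith

/-- The difference of two solutions of the weighted equation is controlled by the difference of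
the coefficients. -/
theorem MagmaProfile.exists_energy_le (n m b : ℝ) {α M β : ℝ} (hα : 0 < α) (hα1 : α ≤ 1)
    (hM : 1 ≤ M) (hβ : 0 < β) :
    ∃ C > 0, ∀ (φ₁ g₁ g₁' φ₂ g₂ g₂' : ℝ → ℝ) (s : ℝ), MagmaProfile n m b α M φ₁ g₁ g₁' →
      MagmaProfile n m b α M φ₂ g₂ g₂' →
      (∀ x, β ≤ φ₁ x ^ m - b ^ 2 * φ₁ x ^ n) → (∀ x, (φ₁ x - φ₂ x) ^ 2 ≤ s) →
      sobolevSq (fun x => g₁ x - g₂ x) (fun x => g₁' x - g₂' x) ≤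
        C * ((∫ x, (Real.exp (b * x) * (φ₁ x - φ₂ x)) ^ 2) + s * sobolevSq g₂ g₂') := by
  obtain ⟨c, hc, hcn⟩ := exists_le_rpow hα (hα1.trans hM) n
  obtain ⟨Kn, hKn, hLn⟩ := exists_abs_rpow_sub_le hα M n
  obtain ⟨Km, hKm, hLm⟩ := exists_abs_rpow_sub_le hα M m
  set κ := min β c
  have hκ : 0 < κ := lt_min hβ hc
  set L := max Kn Km with hLdef
  have hL : 0 < L := lt_max_of_lt_left hKn
  set A := L ^ 2 * (4 * (1 + b ^ 2) ^ 2 + 1) / κ with hA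
  have hA0 : 0 < A := by positivity
  refine ⟨2 * A / κ, by positivity, fun φ₁ g₁ g₁' φ₂ g₂ g₂' s h₁ h₂ hco hs => ?_⟩
  obtain ⟨q₁, hq₁, hq₁'⟩ := h₁.flux
  obtain ⟨q₂, hq₂, hq₂'⟩ := h₂.flux
  have hD := (h₁.isSobolev_flux hα hα1 hM hq₁ hq₁').sub (h₂.isSobolev_flux hα hα1 hM hq₂ hq₂')
  have hG := h₁.sobolev.sub h₂.sobolev
  have hδ : Integrable fun x => (Real.exp (b * x) * (φ₁ x - φ₂ x)) ^ 2 := by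
    have : MemLp (fun x => Real.exp (b * x) * (φ₁ x - φ₂ x)) 2 :=
      (h₁.memLp.sub h₂.memLp).ae_eq (Eventually.of_forall fun x => by
        simp only [Pi.sub_apply]; ring)
    exact this.integrable_sq
  have hsrc : Integrable fun x => A * ((Real.exp (b * x) * (φ₁ x - φ₂ x)) ^ 2
      + s * (g₂ x ^ 2 + g₂' x ^ 2)) :=
    (hδ.add (h₂.sobolev.integrable_sq.const_mul s)).const_mul A
  -- The leading `0` is replaced by `∫ (D G)'`, with `D` the difference of the fluxes, so that the
  -- pointwise inequality can be integrated.
  have key : κ / 2 * sobolevSq (fun x => g₁ x - g₂ x) (fun x => g₁' x - g₂' x) ≤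
      0 + A * ((∫ x, (Real.exp (b * x) * (φ₁ x - φ₂ x)) ^ 2) + s * sobolevSq g₂ g₂') := by
    rw [← hD.integral_mul_deriv hG, sobolevSq, sobolevSq, ← integral_const_mul s,
      ← integral_add hδ (h₂.sobolev.integrable_sq.const_mul s), ← integral_const_mul A,
      ← integral_const_mul, ← integral_add (hD.integrable_mul_deriv hG) hsrc]
    refine integral_mono_ae (hG.integrable_sq.const_mul _)
      ((hD.integrable_mul_deriv hG).add hsrc) ?_
    filter_upwards [hq₁', hq₂'] with x hx₁ hx₂
    have := energy_density_le (G := g₁ x - g₂ x) (G' := g₁' x - g₂' x) (g := g₂ x) (g' := g₂' x)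
      (e := Real.exp (b * x)) hκ ((min_le_left _ _).trans (hco x))
      ((min_le_right _ _).trans (hcn _ (h₁.mem x)))
      ((hLn _ (h₁.mem x) _ (h₂.mem x)).trans (mul_le_mul_of_nonneg_right (le_max_left Kn Km) (abs_nonneg _)))
      ((hLm _ (h₁.mem x) _ (h₂.mem x)).trans (mul_le_mul_of_nonneg_right (le_max_right Kn Km) (abs_nonneg _))) (hs x)
    refine this.trans (le_of_eq ?_)
    simp only [hx₁, hx₂]
    rw [← hLdef, ← hA]
    ring
  rw [div_mul_eq_mul_div, le_div_iff₀ hκ]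
  linarith

/-! ### Lipschitz dependence of the time derivative -/

theorem add_five_sq_le (a b c d e : ℝ) :
    (a + b + c + d + e) ^ 2 ≤ 5 * (a ^ 2 + b ^ 2 + c ^ 2 + d ^ 2 + e ^ 2) := by
  nlinarith [sq_nonneg (a - b), sq_nonneg (a - c), sq_nonneg (a - d), sq_nonneg (a - e),
    sq_nonneg (b - c), sq_nonneg (b - d), sq_nonneg (b - e), sq_nonneg (c - d),
    sq_nonneg (c - e), sq_nonneg (d - e)]

/-- The left side is the `H¹` density of `φ₁ᵐ g₁ - φ₂ᵐ g₂`, telescoped so that each term contains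
exactly one difference. Wherever `p₁`, `p₂` or their difference occurs, known only in `L²`, the
accompanying `G` or `g` is taken in sup norm. -/
theorem product_density_le {B L μ S EG Eg P dm Q dk p₁ p₂ G G' g g' : ℝ}
    (hP : P ^ 2 ≤ B) (hQ : Q ^ 2 ≤ B) (hdm : dm ^ 2 ≤ L * S) (hdk : dk ^ 2 ≤ L * S)
    (hG : G ^ 2 ≤ 2 * EG) (hg : g ^ 2 ≤ 2 * Eg) :
    (P * G + dm * g) ^ 2
      + (P * G' + dm * g' + μ * Q * p₁ * G + μ * Q * (p₁ - p₂) * g + μ * dk * p₂ * g) ^ 2 ≤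
    5 * B * (G ^ 2 + G' ^ 2) + 5 * L * S * (g ^ 2 + g' ^ 2) + 10 * μ ^ 2 * B * EG * p₁ ^ 2
      + 10 * μ ^ 2 * B * Eg * (p₁ - p₂) ^ 2 + 10 * μ ^ 2 * L * S * Eg * p₂ ^ 2 := by
  have h1 : (P * G) ^ 2 ≤ B * G ^ 2 := by rw [mul_pow]; gcongr
  have h2 : (dm * g) ^ 2 ≤ L * S * g ^ 2 := by rw [mul_pow]; gcongr
  have h3 : (P * G') ^ 2 ≤ B * G' ^ 2 := by rw [mul_pow]; gcongr
  have h4 : (dm * g') ^ 2 ≤ L * S * g' ^ 2 := by rw [mul_pow]; gcongr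
  have hB : 0 ≤ B := (sq_nonneg _).trans hP
  have hLS : 0 ≤ L * S := (sq_nonneg _).trans hdm
  have h5 : (μ * Q * p₁ * G) ^ 2 ≤ μ ^ 2 * p₁ ^ 2 * (B * (2 * EG)) := by
    rw [show (μ * Q * p₁ * G) ^ 2 = μ ^ 2 * p₁ ^ 2 * (Q ^ 2 * G ^ 2) by ring]; gcongr
  have h6 : (μ * Q * (p₁ - p₂) * g) ^ 2 ≤ μ ^ 2 * (p₁ - p₂) ^ 2 * (B * (2 * Eg)) := by
    rw [show (μ * Q * (p₁ - p₂) * g) ^ 2 = μ ^ 2 * (p₁ - p₂) ^ 2 * (Q ^ 2 * g ^ 2) by ring]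
    gcongr
  have h7 : (μ * dk * p₂ * g) ^ 2 ≤ μ ^ 2 * p₂ ^ 2 * ((L * S) * (2 * Eg)) := by
    rw [show (μ * dk * p₂ * g) ^ 2 = μ ^ 2 * p₂ ^ 2 * (dk ^ 2 * g ^ 2) by ring]; gcongr
  have h8 := add_five_sq_le (P * G') (dm * g') (μ * Q * p₁ * G) (μ * Q * (p₁ - p₂) * g)
    (μ * dk * p₂ * g)
  have h9 : (P * G + dm * g) ^ 2 ≤ 5 * ((P * G) ^ 2 + (dm * g) ^ 2) := by
    nlinarith [sq_nonneg (P * G - dm * g), sq_nonneg (P * G), sq_nonneg (dm * g)]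
  nlinarith

theorem sq_le_of_abs_le_mul {d L δ T S : ℝ} (h : |d| ≤ L * |δ|) (hδ : δ ^ 2 ≤ T * S) :
    d ^ 2 ≤ T * L ^ 2 * S := by
  calc d ^ 2 = |d| ^ 2 := (sq_abs d).symm
    _ ≤ (L * |δ|) ^ 2 := by gcongr
    _ = L ^ 2 * δ ^ 2 := by rw [mul_pow, sq_abs]
    _ ≤ L ^ 2 * (T * S) := by gcongr
    _ = _ := by ring

/-- The map `φ ↦ exp(b x) ∂ₜφ` is Lipschitz in `H¹` on the relevant set of `φ`. -/
theorem MagmaProfile.exists_sobolevSq_le (n m b : ℝ) {α M β : ℝ} (R : ℝ) (hα : 0 < α)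
    (hα1 : α ≤ 1) (hM : 1 ≤ M) (hβ : 0 < β) :
    ∃ C > 0, ∀ (φ φ' g g' : Fin 2 → ℝ → ℝ) (S : ℝ),
      (∀ j, MagmaProfile n m b α M (φ j) (g j) (g' j)) →
      (∀ j, IsSobolev (fun x => φ j x - 1) (φ' j)) →
      (∀ j x, β ≤ φ j x ^ m - b ^ 2 * φ j x ^ n) →
      (∀ j, sobolevSq (fun x => φ j x - 1) (φ' j) ≤ R) →
      (∀ j, ∫ x, (Real.exp (b * x) * (φ j x - 1)) ^ 2 ≤ R) →
      sobolevSq (fun x => φ 0 x - φ 1 x) (fun x => φ' 0 x - φ' 1 x) ≤ S →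
      ∫ x, (Real.exp (b * x) * (φ 0 x - φ 1 x)) ^ 2 ≤ S →
      sobolevSq (fun x => φ 0 x ^ m * g 0 x - φ 1 x ^ m * g 1 x)
        (fun x => (m * φ 0 x ^ (m - 1) * φ' 0 x * g 0 x + φ 0 x ^ m * g' 0 x)
          - (m * φ 1 x ^ (m - 1) * φ' 1 x * g 1 x + φ 1 x ^ m * g' 1 x)) ≤ C * S := by
  obtain ⟨C₁, hC₁, hen⟩ := MagmaProfile.exists_energy_le n m b hα hα1 hM hβ
  obtain ⟨Bm, hBm, hbm⟩ := exists_abs_rpow_le hα M m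
  obtain ⟨Bk, hBk, hbk⟩ := exists_abs_rpow_le hα M (m - 1)
  obtain ⟨Km, hKm, hLm⟩ := exists_abs_rpow_sub_le hα M m
  obtain ⟨Kk, hKk, hLk⟩ := exists_abs_rpow_sub_le hα M (m - 1)
  set B := (max Bm Bk) ^ 2 with hB
  -- The factor 2 is the Sobolev constant in `(φ 0 x - φ 1 x) ^ 2 ≤ 2 * S`.
  set L := 2 * (max Km Kk) ^ 2 with hL
  have hBpos : 0 < B := pow_pos (lt_max_of_lt_left hBm) 2
  have hLpos : 0 < L := mul_pos two_pos (pow_pos (lt_max_of_lt_left hKm) 2)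
  set E₁ := C₁ * |R| with hE₁
  set E₂ := C₁ * (1 + 2 * E₁) with hE₂
  have hE₁0 : 0 ≤ E₁ := by positivity
  have hE₂0 : 0 ≤ E₂ := by positivity
  refine ⟨5 * B * E₂ + 5 * L * E₁ + 10 * m ^ 2 * B * E₂ * |R| + 10 * m ^ 2 * B * E₁
    + 10 * m ^ 2 * L * E₁ * |R| + 1, by positivity, ?_⟩
  intro φ φ' g g' S hp hφ hco hR hRb hS hSb
  have hS0 : 0 ≤ S := IsSobolev.sobolevSq_nonneg.trans hS
  have hδ : IsSobolev (fun x => φ 0 x - φ 1 x) (fun x => φ' 0 x - φ' 1 x) := by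
    simpa using (hφ 0).sub (hφ 1)
  -- Comparison with the trivial profile: its `g` is zero, so the sup-norm term drops out.
  have hg : sobolevSq (g 1) (g' 1) ≤ E₁ := by
    have := hen (φ 1) (g 1) (g' 1) _ _ _ (2 * sobolevSq (fun x => φ 1 x - 1) (φ' 1)) (hp 1)
      (MagmaProfile.one_zero hα1 hM) (hco 1) (fun x => (hφ 1).sq_le x)
    simp only [sub_zero] at this
    rw [show sobolevSq (fun _ => 0) (fun _ => 0) = 0 by simp [sobolevSq], mul_zero, add_zero]
      at this
    exact this.trans (mul_le_mul_of_nonneg_left ((hRb 1).trans (le_abs_self R)) hC₁.le)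
  have hG : sobolevSq (fun x => g 0 x - g 1 x) (fun x => g' 0 x - g' 1 x) ≤ E₂ * S := by
    refine (hen _ _ _ _ _ _ (2 * S) (hp 0) (hp 1) (hco 0)
      (fun x => (hδ.sq_le x).trans (by linarith))).trans ?_
    rw [show E₂ * S = C₁ * (S + 2 * (S * E₁)) by rw [hE₂]; ring]
    refine mul_le_mul_of_nonneg_left ?_ hC₁.le
    linarith [mul_le_mul_of_nonneg_left hg hS0]
  have hGs := (hp 0).sobolev.sub (hp 1).sobolev
  have hgs := (hp 1).sobolev
  have sqB : ∀ {u v w : ℝ}, |u| ≤ v → v ≤ w → u ^ 2 ≤ w ^ 2 := fun h h' => by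
    rw [← sq_abs]; exact pow_le_pow_left₀ (abs_nonneg _) (h.trans h') 2
  have i1 := hGs.integrable_sq.const_mul (5 * B)
  have i2 := hgs.integrable_sq.const_mul (5 * L * S)
  have i3 := (hφ 0).memLp_deriv.integrable_sq.const_mul (10 * m ^ 2 * B * (E₂ * S))
  have i4 := hδ.memLp_deriv.integrable_sq.const_mul (10 * m ^ 2 * B * E₁)
  have i5 := (hφ 1).memLp_deriv.integrable_sq.const_mul (10 * m ^ 2 * L * S * E₁)
  have main : sobolevSq (fun x => φ 0 x ^ m * g 0 x - φ 1 x ^ m * g 1 x)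
        (fun x => (m * φ 0 x ^ (m - 1) * φ' 0 x * g 0 x + φ 0 x ^ m * g' 0 x)
          - (m * φ 1 x ^ (m - 1) * φ' 1 x * g 1 x + φ 1 x ^ m * g' 1 x)) ≤
      5 * B * sobolevSq (fun x => g 0 x - g 1 x) (fun x => g' 0 x - g' 1 x)
      + 5 * L * S * sobolevSq (g 1) (g' 1) + 10 * m ^ 2 * B * (E₂ * S) * (∫ x, φ' 0 x ^ 2)
      + 10 * m ^ 2 * B * E₁ * (∫ x, (φ' 0 x - φ' 1 x) ^ 2)
      + 10 * m ^ 2 * L * S * E₁ * (∫ x, φ' 1 x ^ 2) := by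
    simp only [sobolevSq]
    rw [← integral_const_mul, ← integral_const_mul, ← integral_const_mul, ← integral_const_mul,
      ← integral_const_mul, ← integral_add i1 i2, ← integral_add (i1.fun_add i2) i3,
      ← integral_add ((i1.fun_add i2).fun_add i3) i4, ← integral_add (((i1.fun_add i2).fun_add i3).fun_add i4) i5]
    refine integral_mono_of_nonneg (Eventually.of_forall fun x => by positivity)
      ((((i1.fun_add i2).fun_add i3).fun_add i4).fun_add i5) (Eventually.of_forall fun x => ?_)
    have hδx := (hδ.sq_le x).trans (mul_le_mul_of_nonneg_left hS zero_le_two)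
    have := product_density_le (μ := m) (p₁ := φ' 0 x) (p₂ := φ' 1 x) (G' := g' 0 x - g' 1 x)
      (g' := g' 1 x)
      (sqB (hbm _ ((hp 0).mem x)) (le_max_left Bm Bk))
      (sqB (hbk _ ((hp 0).mem x)) (le_max_right Bm Bk))
      (sq_le_of_abs_le_mul ((hLm _ ((hp 0).mem x) _ ((hp 1).mem x)).trans
        (mul_le_mul_of_nonneg_right (le_max_left Km Kk) (abs_nonneg _))) hδx)
      (sq_le_of_abs_le_mul ((hLk _ ((hp 0).mem x) _ ((hp 1).mem x)).trans
        (mul_le_mul_of_nonneg_right (le_max_right Km Kk) (abs_nonneg _))) hδx)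
      ((hGs.sq_le x).trans (mul_le_mul_of_nonneg_left hG zero_le_two))
      ((hgs.sq_le x).trans (mul_le_mul_of_nonneg_left hg zero_le_two))
    refine le_trans (le_of_eq ?_) this
    ring
  have hd : ∀ {f f' : ℝ → ℝ}, IsSobolev f f' → ∫ x, f' x ^ 2 ≤ sobolevSq f f' := fun h =>
    integral_mono h.memLp_deriv.integrable_sq h.integrable_sq fun x => by
      exact le_add_of_nonneg_left (sq_nonneg _)
  refine main.trans ?_
  have b1 := mul_le_mul_of_nonneg_left hG (by positivity : 0 ≤ 5 * B)
  have b2 := mul_le_mul_of_nonneg_left hg (by positivity : 0 ≤ 5 * L * S)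
  have b3 := mul_le_mul_of_nonneg_left (((hd (hφ 0)).trans (hR 0)).trans (le_abs_self R))
    (by positivity : 0 ≤ 10 * m ^ 2 * B * (E₂ * S))
  have b4 := mul_le_mul_of_nonneg_left ((hd hδ).trans hS)
    (by positivity : 0 ≤ 10 * m ^ 2 * B * E₁)
  have b5 := mul_le_mul_of_nonneg_left (((hd (hφ 1)).trans (hR 1)).trans (le_abs_self R))
    (by positivity : 0 ≤ 10 * m ^ 2 * L * S * E₁)
  linarith

/-! ### Solutions at a fixed time -/

theorem Continuous.forall_le_of_ae_le {f g : ℝ → ℝ} (hf : Continuous f) (hg : Continuous g)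
    (h : ∀ᵐ x : ℝ, f x ≤ g x) (x : ℝ) : f x ≤ g x := by
  have h1 := (Measure.dense_of_ae h).closure_eq
  rw [(isClosed_le hf hg).closure_eq] at h1
  exact h1.ge (mem_univ x)

theorem sobolevSq_congr {f f' g g' : ℝ → ℝ} (h : f =ᵐ[volume] g) (h' : f' =ᵐ[volume] g') :
    sobolevSq f f' = sobolevSq g g' :=
  integral_congr_ae (by filter_upwards [h, h'] with x hx hx'; rw [hx, hx'])

theorem MagmaEquation.congr {n m : ℝ} {φ ψ w z : ℝ → ℝ} (h : MagmaEquation n m φ w)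
    (hφ : φ =ᵐ[volume] ψ) (hw : w =ᵐ[volume] z) : MagmaEquation n m ψ z := by
  obtain ⟨p, hp, hη⟩ := h
  refine ⟨p, hp.congr (by filter_upwards [hφ, hw] with x hx hx'; rw [hx, hx']) .rfl,
    fun η hηt => ?_⟩
  rw [← hη η hηt]
  congr 1
  · congr 1
    · exact integral_congr_ae (by filter_upwards [hw] with x hx; rw [hx])
    · exact integral_congr_ae (by filter_upwards [hφ] with x hx; rw [hx])
  · exact integral_congr_ae (by filter_upwards [hφ] with x hx; rw [hx])

/-- The equation says that `φⁿ p - φⁿ` has weak derivative `w`, so it has an absolutely continuous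
representative `Q`. Adding 1 before multiplying by `exp(b x)` replaces `φⁿ` by `φⁿ - 1`, for which
the weighted term is controlled by `exp(b x) (φ - 1)`. -/
theorem MagmaEquation.magmaProfile {n m b α M : ℝ} {φ φ' y y' : ℝ → ℝ} (hα : 0 < α)
    (hφ : ACDeriv φ φ') (hφ' : MemLp φ' 2) (hmem : ∀ x, φ x ∈ Icc α M)
    (hwt : MemLp (fun x => Real.exp (b * x) * (φ x - 1)) 2) (hy : IsSobolev y y')
    (h : MagmaEquation n m φ (fun x => Real.exp (-b * x) * y x)) :
    MagmaProfile n m b α M φ (fun x => φ x ^ (-m) * y x)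
      (fun x => -m * φ x ^ (-m - 1) * φ' x * y x + φ x ^ (-m) * y' x) := by
  have hg := IsSobolev.rpow_mul hα hφ hφ' hmem hy (-m)
  set g := fun x => φ x ^ (-m) * y x with hgdef
  set g' := fun x => -m * φ x ^ (-m - 1) * φ' x * y x + φ x ^ (-m) * y' x
  refine ⟨hφ.continuous, hmem, hwt, hg, ?_⟩
  have hv := (ACDeriv.exp_mul (-b)).mul hg.acDeriv
  obtain ⟨p, hp, hη⟩ := h
  obtain ⟨F, hF, hFp⟩ := hp.exists_acDeriv
  have hFv : F = fun x => Real.exp (-b * x) * g x := by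
    refine (hFp.continuous.ae_eq_iff_eq volume hv.continuous).1 ?_
    filter_upwards [hF] with x hx
    rw [hx, hgdef]
    ring
  have hpv := (hFv ▸ hFp).deriv_unique hv
  have hc := continuous_rpow_comp hα hφ.continuous hmem n
  have hloc : LocallyIntegrable fun x => φ x ^ n * p x := by
    simpa [locallyIntegrableOn_univ] using
      (locallyIntegrableOn_univ.2 hp.2.1).continuousOn_mul hc.continuousOn
        (isOpen_univ.isLocallyClosed)
  have hweak : IsWeakDeriv (fun x => φ x ^ n * p x - φ x ^ n)
      (fun x => Real.exp (-b * x) * y x) := by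
    refine ⟨hloc.sub hc.locallyIntegrable, ?_, fun η ht => ?_⟩
    · exact ((ACDeriv.exp_mul (-b)).continuous.mul hy.acDeriv.continuous).locallyIntegrable
    · have h1 := hη η ht
      simp only [sub_mul]
      rw [integral_sub (ht.integrable_mul_deriv hloc)
        (ht.integrable_mul_deriv hc.locallyIntegrable)]
      linarith
  obtain ⟨Q, hQ, hQw⟩ := hweak.exists_acDeriv
  have hexp : ∀ x, Real.exp (b * x) * Real.exp (-b * x) = 1 := fun x => by
    rw [← Real.exp_add]; simp
  refine ⟨fun x => Real.exp (b * x) * (Q x + 1), ?_, ?_⟩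
  · refine ((ACDeriv.exp_mul b).mul (hQw.add (ACDeriv.const 1))).congr_deriv
      (Eventually.of_forall fun x => ?_)
    have h1 : φ x ^ m * φ x ^ (-m) = 1 := by
      rw [← Real.rpow_add (hα.trans_le (hmem x).1)]; simp
    simp only [hgdef]
    linear_combination y x * hexp x - y x * h1
  · filter_upwards [hQ, hpv] with x hx hx'
    rw [hx, hx']
    linear_combination φ x ^ n * (g' x - b * g x) * hexp x

/-! ### The norm of `H¹` -/

theorem L2.norm_sq_eq_integral (f : L2) : ‖f‖ ^ 2 = ∫ x, f x ^ 2 := by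
  rw [← real_inner_self_eq_norm_sq, MeasureTheory.L2.inner_def]
  refine integral_congr_ae (Eventually.of_forall fun x => ?_)
  simp [sq]

theorem H1.sobolevSq_eq (p : H1) {f f' : ℝ → ℝ} (h : f =ᵐ[volume] p.1.fst)
    (h' : f' =ᵐ[volume] p.1.snd) : sobolevSq f f' = ‖p‖ ^ 2 := by
  rw [sobolevSq_congr h h', sobolevSq, integral_add (Lp.memLp _).integrable_sq
    (Lp.memLp _).integrable_sq, ← L2.norm_sq_eq_integral, ← L2.norm_sq_eq_integral,
    Submodule.coe_norm, WithLp.prod_norm_sq_eq_of_L2]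

theorem H1.exists_isSobolev (p : H1) : ∃ f, f =ᵐ[volume] p.1.fst ∧ IsSobolev f p.1.snd := by
  obtain ⟨f, hf, hac⟩ := IsWeakDeriv.exists_acDeriv p.2
  exact ⟨f, hf, hac, (memLp_congr_ae hf).2 (Lp.memLp _), Lp.memLp _⟩

theorem H1.coeFn_sub_fst (p q : H1) :
    ((p - q).1.fst : ℝ → ℝ) =ᵐ[volume] fun x => p.1.fst x - q.1.fst x :=
  Lp.coeFn_sub p.1.fst q.1.fst

theorem H1.coeFn_sub_snd (p q : H1) :
    ((p - q).1.snd : ℝ → ℝ) =ᵐ[volume] fun x => p.1.snd x - q.1.snd x :=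
  Lp.coeFn_sub p.1.snd q.1.snd

theorem H1.integral_sq_le (p : H1) {f : ℝ → ℝ} (h : f =ᵐ[volume] p.1.fst) :
    ∫ x, f x ^ 2 ≤ ‖p‖ ^ 2 := by
  rw [Submodule.coe_norm, WithLp.prod_norm_sq_eq_of_L2, L2.norm_sq_eq_integral,
    integral_congr_ae (g := fun x => p.1.fst x ^ 2) (by filter_upwards [h] with x hx; rw [hx])]
  exact le_add_of_nonneg_right (sq_nonneg _)

/-- Lipschitz dependence on `u` of the weighted time derivative `W = exp(b x) w`. -/
theorem exists_norm_weighted_sub_le (n m b : ℝ) {α β : ℝ} (R : ℝ) (hα : 0 < α) (hβ : 0 < β) :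
    ∃ C > 0, ∀ (u w U W : Fin 2 → H1) (S : ℝ),
      (∀ j, (U j).1.fst =ᵐ[volume] fun x => Real.exp (b * x) * (u j).1.fst x) →
      (∀ j, (W j).1.fst =ᵐ[volume] fun x => Real.exp (b * x) * (w j).1.fst x) →
      (∀ j, MagmaEquation n m (fun x => 1 + (u j).1.fst x) (w j).1.fst) →
      (∀ j, ‖u j‖ ≤ R) → (∀ j, ‖U j‖ ≤ R) →
      (∀ j, ∀ᵐ x : ℝ, α ≤ 1 + (u j).1.fst x) →
      (∀ j, ∀ᵐ x : ℝ, β ≤ (1 + (u j).1.fst x) ^ m - b ^ 2 * (1 + (u j).1.fst x) ^ n) →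
      ‖u 0 - u 1‖ ≤ S → ‖U 0 - U 1‖ ≤ S → ‖W 0 - W 1‖ ≤ C * S := by
  -- The lower bound is capped at 1 so that the interval of values contains 1; the upper bound comes
  -- from the Sobolev embedding.
  have hα₁ : 0 < min α 1 := lt_min hα one_pos
  have hM : 1 ≤ 1 + √(2 * R ^ 2) := le_add_of_nonneg_right (Real.sqrt_nonneg _)
  obtain ⟨C, hC, H⟩ := MagmaProfile.exists_sobolevSq_le n m b (R ^ 2) hα₁ (min_le_right α 1) hM hβ
  refine ⟨√C, Real.sqrt_pos.2 hC, fun u w U W S hU hW heq hu hUR hαu hβu hS hSU => ?_⟩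
  choose f hf hfs using fun j => H1.exists_isSobolev (u j)
  choose y hy hys using fun j => H1.exists_isSobolev (W j)
  have hR : ∀ j, ‖u j‖ ^ 2 ≤ R ^ 2 := fun j => pow_le_pow_left₀ (norm_nonneg _) (hu j) 2
  have hmem : ∀ j x, 1 + f j x ∈ Icc (min α 1) (1 + √(2 * R ^ 2)) := fun j x => by
    constructor
    · refine (min_le_left _ _).trans (Continuous.forall_le_of_ae_le continuous_const
        (continuous_const.add (hfs j).acDeriv.continuous) ?_ x)
      filter_upwards [hαu j, hf j] with x hx hx'
      change α ≤ 1 + f j x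
      rwa [hx']
    · have h1 := (hfs j).abs_le x
      rw [H1.sobolevSq_eq (u j) (hf j) .rfl] at h1
      have h2 : √(2 * ‖u j‖ ^ 2) ≤ √(2 * R ^ 2) := Real.sqrt_le_sqrt (by linarith [hR j])
      linarith [le_abs_self (f j x)]
  have hUf : ∀ j, (fun x => Real.exp (b * x) * (1 + f j x - 1)) =ᵐ[volume] (U j).1.fst :=
    fun j => by
      filter_upwards [hf j, hU j] with x hx hx'
      rw [hx', hx, add_sub_cancel_left]
  have hφ : ∀ j, ACDeriv (fun x => 1 + f j x) (u j).1.snd := fun j => by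
    simpa using (ACDeriv.const 1).add (hfs j).acDeriv
  have hφs : ∀ j, IsSobolev (fun x => 1 + f j x - 1) (u j).1.snd := fun j => by
    simpa using hfs j
  have hprof := fun j => MagmaEquation.magmaProfile hα₁ (hφ j) (hfs j).memLp_deriv (hmem j)
    ((memLp_congr_ae (hUf j)).2 (Lp.memLp _)) (hys j)
    ((heq j).congr (by filter_upwards [hf j] with x hx; rw [hx])
      (by filter_upwards [hy j, hW j] with x hx hx'
          rw [hx, hx', ← mul_assoc, ← Real.exp_add]
          simp))
  have hrpow : ∀ j x, (1 + f j x) ^ m * (1 + f j x) ^ (-m) = 1 := fun j x => by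
    rw [← Real.rpow_add (hα₁.trans_le (hmem j x).1)]; simp
  have hyg : ∀ j, (fun x => (1 + f j x) ^ m * ((1 + f j x) ^ (-m) * y j x)) = y j := fun j => by
    ext x
    rw [← mul_assoc, hrpow, one_mul]
  have hyd := fun j => (IsSobolev.rpow_mul hα₁ (hφ j) (hfs j).memLp_deriv (hmem j)
    (hprof j).sobolev m).acDeriv
  simp only [hyg] at hyd
  -- As `φᵐ g = y`, the product-rule expression and the weak derivative stored in `W j` are
  -- derivatives of the same function.
  have hyd' := fun j => (hyd j).deriv_unique (hys j).acDeriv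
  have key := H _ _ _ _ (S ^ 2) hprof hφs ?_ ?_ ?_ ?_ ?_
  · refine abs_le_of_sq_le_sq' ?_ (mul_nonneg (Real.sqrt_nonneg _) ((norm_nonneg _).trans hS)) |>.2
    rw [mul_pow, Real.sq_sqrt hC.le]
    refine le_trans (le_of_eq ?_) key
    symm
    refine H1.sobolevSq_eq (W 0 - W 1) ?_ ?_
    · filter_upwards [hy 0, hy 1, H1.coeFn_sub_fst (W 0) (W 1)] with x h0 h1 h2
      rw [h2, ← h0, ← h1, congrFun (hyg 0) x, congrFun (hyg 1) x]
    · filter_upwards [hyd' 0, hyd' 1, H1.coeFn_sub_snd (W 0) (W 1)] with x h0 h1 h2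
      exact (congrArg₂ (· - ·) h0 h1).trans h2.symm
  · intro j
    refine Continuous.forall_le_of_ae_le continuous_const
      ((continuous_rpow_comp hα₁ (hφ j).continuous (hmem j) m).sub
        (continuous_const.mul (continuous_rpow_comp hα₁ (hφ j).continuous (hmem j) n))) ?_
    filter_upwards [hβu j, hf j] with x hx hx'
    rwa [hx']
  · intro j
    simp only [add_sub_cancel_left]
    rw [H1.sobolevSq_eq (u j) (hf j) .rfl]
    exact hR j
  · intro j
    exact (H1.integral_sq_le (U j) (hUf j)).trans (pow_le_pow_left₀ (norm_nonneg _) (hUR j) 2)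
  · refine le_trans (le_of_eq (H1.sobolevSq_eq (u 0 - u 1) ?_ ?_))
      (pow_le_pow_left₀ (norm_nonneg _) hS 2)
    · filter_upwards [hf 0, hf 1, H1.coeFn_sub_fst (u 0) (u 1)] with x h0 h1 h2
      rw [h2, h0, h1]
      ring
    · exact (H1.coeFn_sub_snd (u 0) (u 1)).symm
  · refine (H1.integral_sq_le (U 0 - U 1) ?_).trans (pow_le_pow_left₀ (norm_nonneg _) hSU 2)
    filter_upwards [hUf 0, hUf 1, H1.coeFn_sub_fst (U 0) (U 1)] with x h0 h1 h2
    rw [h2, ← h0, ← h1]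
    ring

theorem H1capH1a.norm_eq {a : ℝ} (p : H1capH1a a) : ‖p‖ = ‖p.1.fst‖ + ‖p.1.snd‖ := by
  rw [Submodule.coe_norm, WithLp.prod_norm_eq_of_L1]

/-- The map `u ↦ ∂ₜu` is Lipschitz in `H¹ ∩ H¹ₐ` on the relevant set of `u`. -/
theorem exists_norm_sub_le (n m a : ℝ) {α β : ℝ} (R : ℝ) (hα : 0 < α) (hβ : 0 < β) :
    ∃ K > 0, ∀ u w : Fin 2 → H1capH1a a,
      (∀ j, MagmaEquation n m (porosity (u j)) (toFunction (w j))) →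
      (∀ j, ‖u j‖ ≤ R) → (∀ j, ∀ᵐ x : ℝ, α ≤ porosity (u j) x) →
      (∀ j, ∀ᵐ x : ℝ, β ≤ porosity (u j) x ^ m - a ^ 2 * porosity (u j) x ^ n) →
      ‖w 0 - w 1‖ ≤ K * ‖u 0 - u 1‖ := by
  obtain ⟨c, hc, hcm⟩ := exists_le_rpow hα (le_max_left α (1 + √(2 * R ^ 2))) m
  -- For `b = 0` the coercivity condition reduces to a lower bound on `φᵐ`, supplied by `c`.
  obtain ⟨C₀, hC₀, H₀⟩ := exists_norm_weighted_sub_le n m 0 R hα hc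
  obtain ⟨C₁, hC₁, H₁⟩ := exists_norm_weighted_sub_le n m a R hα hβ
  refine ⟨C₀ + C₁, by positivity, fun u w heq hR hαu hβu => ?_⟩
  have hfst : ∀ p : H1capH1a a, ‖p.1.fst‖ ≤ ‖p‖ := fun p => by
    rw [H1capH1a.norm_eq p]; exact le_add_of_nonneg_right (norm_nonneg _)
  have hsnd : ∀ p : H1capH1a a, ‖p.1.snd‖ ≤ ‖p‖ := fun p => by
    rw [H1capH1a.norm_eq p]; exact le_add_of_nonneg_left (norm_nonneg _)
  have h₀ := H₀ (fun j => (u j).1.fst) (fun j => (w j).1.fst) (fun j => (u j).1.fst)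
    (fun j => (w j).1.fst) ‖u 0 - u 1‖ (fun j => by simp) (fun j => by simp) heq
    (fun j => (hfst _).trans (hR j)) (fun j => (hfst _).trans (hR j)) hαu (fun j => ?_)
    (hfst (u 0 - u 1)) (hfst (u 0 - u 1))
  · have h₁ := H₁ (fun j => (u j).1.fst) (fun j => (w j).1.fst) (fun j => (u j).1.snd)
      (fun j => (w j).1.snd) ‖u 0 - u 1‖ (fun j => (u j).2) (fun j => (w j).2) heq
      (fun j => (hfst _).trans (hR j)) (fun j => (hsnd _).trans (hR j)) hαu hβu
      (hfst (u 0 - u 1)) (hsnd (u 0 - u 1))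
    rw [H1capH1a.norm_eq (w 0 - w 1), add_mul]
    exact add_le_add h₀ h₁
  · obtain ⟨f, hf, hfs⟩ := H1.exists_isSobolev (u j).1.fst
    filter_upwards [hαu j, hf] with x hx hx'
    have h1 := hfs.abs_le x
    rw [H1.sobolevSq_eq _ hf .rfl] at h1
    have h2 : √(2 * ‖(u j).1.fst‖ ^ 2) ≤ √(2 * R ^ 2) := by
      have := pow_le_pow_left₀ (norm_nonneg _) ((hfst _).trans (hR j)) 2
      exact Real.sqrt_le_sqrt (by linarith)
    rw [hx'] at h1
    have h3 := hcm (1 + (u j).1.fst.1.fst x) ⟨hx, le_max_of_le_right (by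
      linarith [le_abs_self ((u j).1.fst.1.fst x)])⟩
    simpa using h3

/-- Gronwall's inequality for the difference of two `C¹` curves. -/
theorem norm_sub_le_exp_of_derivWithin {E : Type*} [NormedAddCommGroup E] [NormedSpace ℝ E]
    {K T : ℝ} {u v : ℝ → E} (hu : ContDiffOn ℝ 1 u (Icc 0 T)) (hv : ContDiffOn ℝ 1 v (Icc 0 T))
    (h : ∀ t ∈ Icc 0 T, ‖derivWithin u (Icc 0 T) t - derivWithin v (Icc 0 T) t‖ ≤
      K * ‖u t - v t‖) (t : ℝ) (ht : t ∈ Icc 0 T) :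
    ‖u t - v t‖ ≤ Real.exp (K * t) * ‖u 0 - v 0‖ := by
  -- Gronwall's inequality needs right derivatives; `Icc 0 T` is a right neighbourhood of every `t <
  -- T`.
  have hd : ∀ w : ℝ → E, ContDiffOn ℝ 1 w (Icc 0 T) → ∀ t ∈ Ico 0 T,
      HasDerivWithinAt w (derivWithin w (Icc 0 T) t) (Ici t) t := fun w hw t ht =>
    (hw.differentiableOn (by norm_num) t
      (Ico_subset_Icc_self ht)).hasDerivWithinAt.mono_of_mem_nhdsWithin
      (mem_of_superset (Ico_mem_nhdsGE ht.2) fun s hs => ⟨ht.1.trans hs.1, hs.2.le⟩)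
  have h := norm_le_gronwallBound_of_norm_deriv_right_le (f := fun t => u t - v t)
    (K := K) (ε := 0) (hu.continuousOn.sub hv.continuousOn)
    (fun t ht => (hd u hu t ht).sub (hd v hv t ht)) le_rfl
    (fun t ht => by rw [add_zero]; exact h t (Ico_subset_Icc_self ht)) t ht
  rwa [gronwallBound_ε0, sub_zero, mul_comm] at h

/-- Infima over `x` are those of the continuous representative of `φ = 1 + u`, so that
`inf ≥ α₀` says `≥ α₀` almost everywhere. -/
theorem theorem2p2 (n m a R α₀ β₀ : ℝ) (ha0 : 0 < a) (ha1 : a < 1) (hα : 0 < α₀) (hβ : 0 < β₀) :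
    ∃ K : ℝ, ∀ T : ℝ, 0 < T → ∀ u : Fin 2 → ℝ → H1capH1a a,
      (∀ j, IsMagmaSolution n m a T (u j)) →
      (∀ j, ∀ t ∈ Icc 0 T, ‖u j t‖ ≤ R) →
      (∀ j, ∀ t ∈ Icc 0 T, ∀ᵐ x : ℝ, α₀ ≤ porosity (u j t) x) →
      (∀ j, ∀ t ∈ Icc 0 T, ∀ᵐ x : ℝ,
        β₀ ≤ porosity (u j t) x ^ m - a ^ 2 * porosity (u j t) x ^ n) →
      ∀ t ∈ Icc 0 T, ‖u 0 t - u 1 t‖ ≤ Real.exp (K * t) * ‖u 0 0 - u 1 0‖ := by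
  obtain ⟨K, -, hK⟩ := exists_norm_sub_le n m a R hα hβ
  refine ⟨K, fun T _ u hu hR hαu hβu => norm_sub_le_exp_of_derivWithin (E := H1capH1a a) (hu 0).1 (hu 1).1
    fun t ht => ?_⟩
  exact hK (fun j => u j t) (fun j => derivWithin (u j) (Icc 0 T) t)
    (fun j => (hu j).2 t ht) (fun j => hR j t ht) (fun j => hαu j t ht) (fun j => hβu j t ht)
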